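/- Let $\sigma>0$ and let $\beta=(\beta_j)_{j\ge 1}$ be a real sequence with finitely many non-zero terms; put $k^*=|\{j:\beta_j\ne 0\}|$. For a sample size $n$ consider the regression model $y_i=h(x_i)+e_i$, $i=1,\dots,n$, with fixed points $x_1,\dots,x_n\in\mathbb R^m$, with $e_1,\dots,e_n$ i.i.d. $N(0,\sigma^2)$, and with $h=\sum_{j=1}^n\beta_j g_j$ for functions $g_j:\mathbb R^m\to\mathbb R$ such that the $n\times n$ matrix $G=(g_j(x_i))_{i,j}$ satisfies $G'G=nI_n$. Write $\boldsymbol h=(h(x_1),\dots,h(x_n))'$ and, in dimension $n$, $\beta=(\beta_1,\dots,\beta_n)'$. Let $\hat c=\frac1n G'y$ be the least squares estimator, let $\hat\theta_k$ be the $(k+1)$-th largest of $|\hat c_1|,\dots,|\hat c_n|$, and let $\hat b_k$ be the LARS-based soft-thresholding estimator, $\hat b_{k,j}=(|\hat c_j|-\hat\theta_k)_+\,\mathrm{sign}(\hat c_j)$. The risk of the naive estimator is $$R_{n,k}(\mathbf 1_n)=\frac1n\,\mathbb E\|G\hat b_k-\boldsymbol h\|^2 .$$ The risk under adaptive scaling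 is $$R_{\rm AS}(n,k)=\mathbb E\|\hat A\hat b_k-\beta\|^2,\qquad \hat A=\mathrm{diag}(\hat\alpha_1,\dots,\hat\alpha_n),$$ where $\hat\alpha_j=1+\hat\theta_k/|\hat c_j|$ if $\hat c_j\ne0$ and $\hat\alpha_j=\alpha$, an arbitrary real constant, if $\hat c_j=0$. Then for every $\varepsilon>0$ there is an $N$, depending only on $\sigma$, $\beta$ and $\varepsilon$, such that for all $n\ge N$ and every such model of size $n$, both risks at $k=k^*$ are finite and $$R_{n,k^*}(\mathbf 1_n)-R_{\rm AS}(n,k^*)\ \ge\ (1-\varepsilon)\,2\sigma^2k^*\,\frac{\log n}{n},$$ and moreover $R_{\rm AS}(n,k^*)<R_{n,k^*}(\mathbf 1_n)$ if $k^*\ge 1$. -/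

import Mathlib

open MeasureTheory ProbabilityTheory
open scoped Matrix

noncomputable section

namespace AdaptiveScaling

/-- The `n × n` design matrix, with `(i, j)` entry `g_j(x_i)`. Indices start at `0`, so
`g 0, …, g (n - 1)` are the first `n` functions of the series. -/
def designMatrix {m n : ℕ} (g : ℕ → (Fin m → ℝ) → ℝ) (x : Fin n → Fin m → ℝ) :
    Matrix (Fin n) (Fin n) ℝ :=
  Matrix.of fun i j => g j (x i)

/-- The least squares estimator `ĉ = n⁻¹ Gᵀ y` under the orthogonality condition. -/
def leastSquares {n : ℕ} (G : Matrix (Fin n) (Fin n) ℝ) (y : Fin n → ℝ) : Fin n → ℝ :=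
  (1 / (n : ℝ)) • (Gᵀ *ᵥ y)

/-- A permutation `p` with `|c (p 0)| ≥ |c (p 1)| ≥ ⋯ ≥ |c (p (n - 1))|`. -/
def order {n : ℕ} (c : Fin n → ℝ) : Equiv.Perm (Fin n) :=
  Tuple.sort fun j => -|c j|

theorem antitone_abs_order {n : ℕ} (c : Fin n → ℝ) : Antitone fun i => |c (order c i)| := by
  intro i j hij
  have h := Tuple.monotone_sort (fun j => -|c j|) hij
  simp only [Function.comp_apply, neg_le_neg_iff] at h
  exact h

/-- The data-dependent threshold `θ̂_k`: the `(k + 1)`-th largest of `|c 0|, …, |c (n - 1)|`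
(and `0` if `k ≥ n`, when nothing is removed). -/
def threshold {n : ℕ} (c : Fin n → ℝ) (k : ℕ) : ℝ :=
  if hk : k < n then |c (order c ⟨k, hk⟩)| else 0

/-- The LARS-based soft-thresholding estimator `b̂_{k,j} = (|ĉ_j| - θ̂_k)₊ sign(ĉ_j)`. -/
def softThreshold {n : ℕ} (c : Fin n → ℝ) (k : ℕ) (j : Fin n) : ℝ :=
  max (|c j| - threshold c k) 0 * Real.sign (c j)

/-- The adaptive scaling `α̂_j = 1 + θ̂_k / |ĉ_j|`, with the constant `α` where `ĉ_j = 0`. -/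
def adaptiveScale {n : ℕ} (α : ℝ) (c : Fin n → ℝ) (k : ℕ) (j : Fin n) : ℝ :=
  if c j ≠ 0 then 1 + threshold c k / |c j| else α

/-- The loss `n⁻¹ ‖G A b̂_k - h‖²` of soft-thresholding with the component-wise scaling
`A = diag(a)`, where `h` is the vector of target values at the sample points. -/
def scaledLoss {n : ℕ} (G : Matrix (Fin n) (Fin n) ℝ) (h : Fin n → ℝ) (k : ℕ) (a : Fin n → ℝ)
    (y : Fin n → ℝ) : ℝ :=
  (1 / (n : ℝ)) *
    ∑ i, ((G *ᵥ (Matrix.diagonal a *ᵥ softThreshold (leastSquares G y) k)) i - h i) ^ 2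

/-- The loss `‖Â b̂_k - β‖²` of soft-thresholding with adaptive scaling `Â = diag(α̂)`. -/
def adaptiveLoss {n : ℕ} (α : ℝ) (G : Matrix (Fin n) (Fin n) ℝ) (β : Fin n → ℝ) (k : ℕ)
    (y : Fin n → ℝ) : ℝ :=
  ∑ j, ((Matrix.diagonal (adaptiveScale α (leastSquares G y) k) *ᵥ
    softThreshold (leastSquares G y) k) j - β j) ^ 2

/-- The risk `R_{n,k}(a) = n⁻¹ E ‖G A b̂_k - h‖²`, where the observation is `y`. -/
def scaledRisk {Ω : Type*} [MeasurableSpace Ω] (P : Measure Ω) {n : ℕ}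
    (G : Matrix (Fin n) (Fin n) ℝ) (h : Fin n → ℝ) (k : ℕ) (a : Fin n → ℝ)
    (y : Ω → Fin n → ℝ) : ℝ :=
  ∫ ω, scaledLoss G h k a (y ω) ∂P

/-- The risk `R_AS(n,k) = E ‖Â b̂_k - β‖²`, where the observation is `y`. -/
def adaptiveRisk {Ω : Type*} [MeasurableSpace Ω] (P : Measure Ω) {n : ℕ} (α : ℝ)
    (G : Matrix (Fin n) (Fin n) ℝ) (β : Fin n → ℝ) (k : ℕ) (y : Ω → Fin n → ℝ) : ℝ :=
  ∫ ω, adaptiveLoss α G β k (y ω) ∂P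

end AdaptiveScaling

end

/-! Orthogonality turns the model into a sequence model: `ĉ = β + ξ`, where the `ξ_j` are i.i.d.
`N(0, σ²/n)`, and both losses become coordinatewise sums of squares. Let `S` be the support of `β`,
`b` a positive lower bound for `|β_j|` on `S`, and `T` the largest `|ξ_j|` off `S`.

If `‖ξ‖ ≤ b/4` (sup norm), then at `k = k*` the threshold is exactly `T` and exactly `S` is kept. On
`S` plain soft-thresholding has error `ξ_j - T sign β_j`, while adaptive scaling has error `ξ_j -
T²/ĉ_j`, whose bias is of second order. The difference of the squares is `T² - 2T sign(β_j) ξ_j` up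
to `O(‖ξ‖³)`. On the complementary event the cubic term is large enough for the same lower bound to
persist, so `loss_gain_ge` holds pointwise without exception.

Taking expectations, the cross term vanishes, since `T` depends only on coordinates off `S`. The
maximum of `n - k*` Gaussians gives `E T² ≥ (1 - o(1)) 2σ² log n / n`, and `E‖ξ‖³ = O(1/n)` is of
lower order. All constants depend only on `σ` and `β`, which makes the bound uniform over models. -/

namespace AdaptiveScaling

/-! ### The threshold as an order statistic. -/

section Threshold

variable {n : ℕ} (c : Fin n → ℝ)

theorem threshold_nonneg (k : ℕ) : 0 ≤ threshold c k := by
  unfold threshold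
  split_ifs <;> positivity

/-- Pigeonhole: the `k + 1` top positions of the ordering cannot all lie in `A`. -/
theorem exists_threshold_le {k : ℕ} (hk : k < n) {A : Finset (Fin n)} (hA : A.card ≤ k) :
    ∃ j, j ∉ A ∧ threshold c k ≤ |c j| := by
  have hcard : A.card < ((Finset.univ.filter fun i : Fin n => (i : ℕ) < k + 1).image
      (order c)).card := by
    rw [Finset.card_image_of_injective _ (order c).injective, Fin.card_filter_val_lt]
    omega
  obtain ⟨j, hj, hjA⟩ := Finset.exists_mem_notMem_of_card_lt_card hcard
  obtain ⟨i, hi, rfl⟩ := Finset.mem_image.mp hj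
  refine ⟨_, hjA, ?_⟩
  rw [threshold, dif_pos hk]
  refine antitone_abs_order c ?_
  rw [Fin.le_def]
  simp only [Finset.mem_filter, Finset.mem_univ, true_and] at hi
  exact Nat.lt_succ_iff.mp hi

theorem card_threshold_lt_abs_le (k : ℕ) :
    (Finset.univ.filter fun j => threshold c k < |c j|).card ≤ k := by
  by_cases hk : k < n
  · have hsub : (Finset.univ.filter fun j => threshold c k < |c j|) ⊆
        (Finset.univ.filter fun i : Fin n => (i : ℕ) < k).image (order c) := by
      intro j hj
      obtain ⟨i, rfl⟩ := (order c).surjective j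
      refine Finset.mem_image_of_mem _ ?_
      simp only [Finset.mem_filter, Finset.mem_univ, true_and] at hj ⊢
      by_contra hi
      rw [threshold, dif_pos hk] at hj
      exact absurd (antitone_abs_order c (show (⟨k, hk⟩ : Fin n) ≤ i from not_lt.mp hi))
        (not_le.mpr hj)
    calc _ ≤ _ := Finset.card_le_card hsub
      _ ≤ _ := Finset.card_image_le
      _ ≤ k := by rw [Fin.card_filter_val_lt]; omega
  · calc _ ≤ (Finset.univ : Finset (Fin n)).card := Finset.card_filter_le _ _
      _ ≤ k := by simpa using not_lt.mp hk

/-- Describes sublevel sets by counting exceedances, so that measurability of the threshold needs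
nothing about the sorting permutation. -/
theorem threshold_le_iff {k : ℕ} (hk : k < n) (t : ℝ) :
    threshold c k ≤ t ↔ (Finset.univ.filter fun j => t < |c j|).card ≤ k := by
  constructor
  · intro h
    refine (Finset.card_le_card fun j hj => ?_).trans (card_threshold_lt_abs_le c k)
    simp only [Finset.mem_filter, Finset.mem_univ, true_and] at hj ⊢
    exact h.trans_lt hj
  · intro h
    obtain ⟨j, hj, hle⟩ := exists_threshold_le c hk h
    simp only [Finset.mem_filter, Finset.mem_univ, true_and, not_lt] at hj
    exact hle.trans hj

theorem measurable_threshold (k : ℕ) : Measurable fun c : Fin n → ℝ => threshold c k := by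
  by_cases hk : k < n
  · refine measurable_of_Iic fun t => ?_
    have h : (fun c : Fin n → ℝ => threshold c k) ⁻¹' Set.Iic t =
        {c | ∑ j, (if t < |c j| then 1 else 0) ≤ k} := by
      ext c
      simp only [Set.mem_preimage, Set.mem_Iic, Set.mem_ofPred_eq, threshold_le_iff c hk,
        Finset.card_filter]
    rw [h]
    refine measurableSet_le (Finset.measurable_sum _ fun j _ => ?_) measurable_const
    exact Measurable.ite (measurableSet_lt measurable_const (by fun_prop)) measurable_const
      measurable_const
  · simp [threshold, hk]

end Threshold

/-! ### Closed forms and measurability of the estimators. -/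

section Estimators

variable {n : ℕ} {c : Fin n → ℝ} {k : ℕ} {j : Fin n}

theorem softThreshold_of_le (h : |c j| ≤ threshold c k) : softThreshold c k j = 0 := by
  rw [softThreshold, max_eq_right (by linarith), zero_mul]

theorem softThreshold_of_lt (h : threshold c k < |c j|) :
    softThreshold c k j = c j - threshold c k * Real.sign (c j) := by
  rw [softThreshold, max_eq_left (by linarith), sub_mul]
  congr 1
  rcases lt_trichotomy (c j) 0 with hc | hc | hc
  · simp [Real.sign_of_neg hc, abs_of_neg hc]
  · simp [hc]
  · simp [Real.sign_of_pos hc, abs_of_pos hc]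

/-- In absolute value this is `(1 + θ/|c|)(|c| - θ) = |c| - θ²/|c|`: the first-order shrinkage
cancels. The constant `α` plays no role, because a kept coordinate is non-zero. -/
theorem adaptiveScale_mul_softThreshold_of_lt (α : ℝ) (h : threshold c k < |c j|) :
    adaptiveScale α c k j * softThreshold c k j = c j - threshold c k ^ 2 / c j := by
  have hc : c j ≠ 0 := abs_pos.mp ((threshold_nonneg c k).trans_lt h)
  rw [softThreshold_of_lt h, adaptiveScale, if_pos hc]
  rcases lt_or_gt_of_ne hc with hc' | hc'
  · rw [Real.sign_of_neg hc', abs_of_neg hc']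
    field_simp
    ring
  · rw [Real.sign_of_pos hc', abs_of_pos hc']
    field_simp
    ring

theorem measurable_sign : Measurable Real.sign := by
  unfold Real.sign
  exact Measurable.ite measurableSet_Iio measurable_const
    (Measurable.ite measurableSet_Ioi measurable_const measurable_const)

theorem measurable_softThreshold (k : ℕ) (j : Fin n) :
    Measurable fun c : Fin n → ℝ => softThreshold c k j := by
  have h := measurable_threshold (n := n) k
  have h' : Measurable fun c : Fin n → ℝ => Real.sign (c j) :=
    measurable_sign.comp (measurable_pi_apply j)
  unfold softThreshold
  fun_prop

theorem measurable_adaptiveScale (α : ℝ) (k : ℕ) (j : Fin n) :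
    Measurable fun c : Fin n → ℝ => adaptiveScale α c k j := by
  have h := measurable_threshold (n := n) k
  unfold adaptiveScale
  refine Measurable.ite ?_ (by fun_prop) measurable_const
  exact (measurableSet_eq_fun (measurable_pi_apply j) measurable_const).compl

end Estimators

/-! ### Reduction to the sequence model and pointwise comparison of losses. -/

section Losses

variable {n : ℕ} {G : Matrix (Fin n) (Fin n) ℝ} {β ξ : Fin n → ℝ} {k : ℕ}

theorem leastSquares_mulVec_add (hn : n ≠ 0)
    (hG : Gᵀ * G = (n : ℝ) • (1 : Matrix (Fin n) (Fin n) ℝ)) (β e : Fin n → ℝ) :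
    leastSquares G (G *ᵥ β + e) = β + leastSquares G e := by
  have hn' : (n : ℝ) ≠ 0 := Nat.cast_ne_zero.mpr hn
  rw [leastSquares, Matrix.mulVec_add, Matrix.mulVec_mulVec, hG, smul_add, leastSquares,
    Matrix.smul_mulVec, Matrix.one_mulVec, smul_smul, one_div_mul_cancel hn', one_smul]

theorem mean_sq_mulVec_sub (hn : n ≠ 0)
    (hG : Gᵀ * G = (n : ℝ) • (1 : Matrix (Fin n) (Fin n) ℝ)) (u v : Fin n → ℝ) :
    (1 / (n : ℝ)) * ∑ i, ((G *ᵥ u) i - (G *ᵥ v) i) ^ 2 = ∑ j, (u j - v j) ^ 2 := by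
  have hn' : (n : ℝ) ≠ 0 := Nat.cast_ne_zero.mpr hn
  have h1 : ∑ i, ((G *ᵥ u) i - (G *ᵥ v) i) ^ 2 = (G *ᵥ (u - v)) ⬝ᵥ (G *ᵥ (u - v)) := by
    rw [Matrix.mulVec_sub, dotProduct]
    exact Finset.sum_congr rfl fun i _ => by rw [Pi.sub_apply, sq]
  have h2 : (G *ᵥ (u - v)) ⬝ᵥ (G *ᵥ (u - v)) = n * ((u - v) ⬝ᵥ (u - v)) := by
    rw [Matrix.dotProduct_mulVec, Matrix.vecMul_mulVec, hG, Matrix.vecMul_smul,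
      Matrix.vecMul_one, smul_dotProduct, smul_eq_mul]
  rw [h1, h2, ← mul_assoc, one_div_mul_cancel hn', one_mul, dotProduct]
  exact Finset.sum_congr rfl fun i _ => by rw [Pi.sub_apply, sq]

theorem scaledLoss_one (hn : n ≠ 0)
    (hG : Gᵀ * G = (n : ℝ) • (1 : Matrix (Fin n) (Fin n) ℝ)) (β e : Fin n → ℝ) (k : ℕ) :
    scaledLoss G (G *ᵥ β) k (fun _ => 1) (G *ᵥ β + e) =
      ∑ j, (softThreshold (β + leastSquares G e) k j - β j) ^ 2 := by
  rw [scaledLoss, leastSquares_mulVec_add hn hG, mean_sq_mulVec_sub hn hG]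
  simp

theorem adaptiveLoss_eq (hn : n ≠ 0)
    (hG : Gᵀ * G = (n : ℝ) • (1 : Matrix (Fin n) (Fin n) ℝ)) (α : ℝ) (β e : Fin n → ℝ) (k : ℕ) :
    adaptiveLoss α G β k (G *ᵥ β + e) =
      ∑ j, (adaptiveScale α (β + leastSquares G e) k j *
        softThreshold (β + leastSquares G e) k j - β j) ^ 2 := by
  rw [adaptiveLoss, leastSquares_mulVec_add hn hG]
  simp [Matrix.mulVec_diagonal]

/-- The positions of the non-zero coefficients. -/
noncomputable def nonzeroSet (β : Fin n → ℝ) : Finset (Fin n) :=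
  Finset.univ.filter fun j => β j ≠ 0

/-- The largest absolute error over the positions with zero coefficient. -/
noncomputable def nullMax (β ξ : Fin n → ℝ) : ℝ :=
  ‖fun j : ↥(nonzeroSet β)ᶜ => ξ j‖

theorem mem_nonzeroSet {j : Fin n} : j ∈ nonzeroSet β ↔ β j ≠ 0 := by
  simp [nonzeroSet]

theorem nullMax_nonneg : 0 ≤ nullMax β ξ := norm_nonneg _

theorem abs_le_nullMax {j : Fin n} (hj : β j = 0) : |ξ j| ≤ nullMax β ξ := by
  have hj' : j ∈ (nonzeroSet β)ᶜ := by simpa [mem_nonzeroSet] using hj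
  exact norm_le_pi_norm (fun j : ↥(nonzeroSet β)ᶜ => ξ j) ⟨j, hj'⟩

theorem nullMax_le_norm : nullMax β ξ ≤ ‖ξ‖ :=
  (pi_norm_le_iff_of_nonneg (norm_nonneg _)).mpr fun j => norm_le_pi_norm ξ j

/-- Among the top `k* + 1` entries at least one lies off the support, where the entry is pure noise.
-/
theorem threshold_le_nullMax (hk : (nonzeroSet β).card < n) :
    threshold (β + ξ) (nonzeroSet β).card ≤ nullMax β ξ := by
  obtain ⟨j, hj, hle⟩ := exists_threshold_le (β + ξ) hk le_rfl
  have hj' : β j = 0 := by simpa [mem_nonzeroSet] using hj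
  refine hle.trans ?_
  simpa [hj'] using abs_le_nullMax (ξ := ξ) hj'

/-- For the lower bound, add a null position `i` to the support: one of these `k* + 1` positions has
absolute value at most the threshold, and each of them dominates `|ξ i|`. -/
theorem threshold_eq_nullMax (hk : (nonzeroSet β).card < n)
    (hdom : ∀ i, β i ≠ 0 → ∀ j, β j = 0 → |ξ j| ≤ |β i + ξ i|) :
    threshold (β + ξ) (nonzeroSet β).card = nullMax β ξ := by
  refine le_antisymm (threshold_le_nullMax hk)
    ((pi_norm_le_iff_of_nonneg (threshold_nonneg _ _)).mpr fun ⟨i, hi⟩ => ?_)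
  have hi' : i ∉ nonzeroSet β := by simpa using hi
  have hi0 : β i = 0 := by simpa [mem_nonzeroSet] using hi'
  have hcard : (Finset.univ.filter fun j => threshold (β + ξ) (nonzeroSet β).card
      < |(β + ξ) j|).card < (insert i (nonzeroSet β)).card := by
    rw [Finset.card_insert_of_notMem hi']
    exact Nat.lt_succ_of_le (card_threshold_lt_abs_le _ _)
  obtain ⟨j, hj, hj'⟩ := Finset.exists_mem_notMem_of_card_lt_card hcard
  simp only [Finset.mem_filter, Finset.mem_univ, true_and, not_lt] at hj'
  refine le_trans ?_ hj'
  rcases Finset.mem_insert.mp hj with rfl | hj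
  · simp [hi0]
  · exact hdom j (mem_nonzeroSet.mp hj) i hi0

theorem abs_softThreshold_sub_le (hk : (nonzeroSet β).card < n) (j : Fin n) :
    |softThreshold (β + ξ) (nonzeroSet β).card j - β j| ≤ 2 * ‖ξ‖ := by
  have hθ := (threshold_le_nullMax (ξ := ξ) hk).trans nullMax_le_norm
  have hξ : |ξ j| ≤ ‖ξ‖ := norm_le_pi_norm ξ j
  have h0 := threshold_nonneg (β + ξ) (nonzeroSet β).card
  rcases le_or_gt |(β + ξ) j| (threshold (β + ξ) (nonzeroSet β).card) with h | h
  · rw [softThreshold_of_le h]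
    rw [Pi.add_apply, abs_le] at h
    rw [abs_le] at hξ ⊢
    constructor <;> linarith
  · rw [softThreshold_of_lt h]
    have hs : |threshold (β + ξ) (nonzeroSet β).card * Real.sign ((β + ξ) j)| ≤ ‖ξ‖ := by
      rw [abs_mul, abs_of_nonneg h0]
      rcases Real.sign_apply_eq ((β + ξ) j) with hs | hs | hs <;> rw [hs] <;> simp [hθ]
    rw [abs_le] at hξ hs ⊢
    rw [Pi.add_apply] at *
    constructor <;> linarith

theorem abs_adaptive_sub_le (hk : (nonzeroSet β).card < n) (α : ℝ) (j : Fin n) :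
    |adaptiveScale α (β + ξ) (nonzeroSet β).card j *
      softThreshold (β + ξ) (nonzeroSet β).card j - β j| ≤ 2 * ‖ξ‖ := by
  have hθ := (threshold_le_nullMax (ξ := ξ) hk).trans nullMax_le_norm
  have hξ : |ξ j| ≤ ‖ξ‖ := norm_le_pi_norm ξ j
  have h0 := threshold_nonneg (β + ξ) (nonzeroSet β).card
  rcases le_or_gt |(β + ξ) j| (threshold (β + ξ) (nonzeroSet β).card) with h | h
  · rw [softThreshold_of_le h, mul_zero]
    rw [Pi.add_apply, abs_le] at h
    rw [abs_le] at hξ ⊢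
    constructor <;> linarith
  · rw [adaptiveScale_mul_softThreshold_of_lt α h]
    have hs : |threshold (β + ξ) (nonzeroSet β).card ^ 2 / (β + ξ) j| ≤ ‖ξ‖ := by
      rw [abs_div, abs_pow, abs_of_nonneg h0, div_le_iff₀ (h0.trans_lt h)]
      nlinarith
    rw [abs_le] at hξ hs ⊢
    rw [Pi.add_apply] at *
    constructor <;> linarith

/-- With `r = θ²/(β + ξ)`, the squares differ by `θ² - 2θ sign(β) ξ + (2ξ - r) r`. Since `|β + ξ| ≥
b/2`, `r` is `O(M²)` and the last term is `O(M³)`. The constant 6 would do here; 28 is what large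
noise requires. -/
theorem sq_sub_sq_ge {b β ξ M θ : ℝ} (hb : 0 < b) (hβ : b ≤ |β|) (hM : M ≤ b / 4)
    (hξ : |ξ| ≤ M) (h0 : 0 ≤ θ) (hθ : θ ≤ M) :
    θ ^ 2 - 2 * θ * (Real.sign β * ξ) - 28 / b * M ^ 3 ≤
      (β + ξ - θ * Real.sign (β + ξ) - β) ^ 2 - (β + ξ - θ ^ 2 / (β + ξ) - β) ^ 2 := by
  have hM0 : 0 ≤ M := h0.trans hθ
  have hξ' := abs_le.mp hξ
  have hsign : Real.sign (β + ξ) = Real.sign β ∧ Real.sign β ^ 2 = 1 := by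
    rcases le_abs.mp hβ with h | h
    · rw [Real.sign_of_pos (by linarith), Real.sign_of_pos (by linarith)]; norm_num
    · rw [Real.sign_of_neg (by linarith), Real.sign_of_neg (by linarith)]; norm_num
  have hc : b / 2 ≤ |β + ξ| := by
    have := abs_sub_abs_le_abs_sub β (-ξ)
    rw [abs_neg, sub_neg_eq_add] at this
    linarith
  set r := θ ^ 2 / (β + ξ) with hr
  have hrabs : |r| ≤ 2 / b * M ^ 2 := by
    rw [hr, abs_div, abs_of_nonneg (sq_nonneg θ), div_le_iff₀ (by linarith)]
    have h1 : θ ^ 2 ≤ M ^ 2 := by gcongr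
    calc θ ^ 2 ≤ M ^ 2 := h1
      _ = 2 / b * M ^ 2 * (b / 2) := by field_simp
      _ ≤ 2 / b * M ^ 2 * |β + ξ| := by gcongr
  have hr1 : |r| ≤ M := by
    refine hrabs.trans ?_
    rw [div_mul_eq_mul_div, div_le_iff₀ hb]
    nlinarith
  have hcross : |2 * ξ * r - r ^ 2| ≤ 3 * M * |r| := by
    have : 2 * ξ * r - r ^ 2 = (2 * ξ - r) * r := by ring
    rw [this, abs_mul]
    gcongr
    rw [abs_le] at hr1 ⊢
    constructor <;> linarith
  have hfin : 3 * M * |r| ≤ 28 / b * M ^ 3 := by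
    calc 3 * M * |r| ≤ 3 * M * (2 / b * M ^ 2) := by gcongr
      _ = 6 / b * M ^ 3 := by ring
      _ ≤ 28 / b * M ^ 3 := by gcongr; norm_num
  have hlow := (abs_le.mp (hcross.trans hfin)).1
  rw [hsign.1]
  have : (β + ξ - θ * Real.sign β - β) ^ 2 - (β + ξ - r - β) ^ 2 =
      θ ^ 2 * Real.sign β ^ 2 - 2 * θ * (Real.sign β * ξ) + (2 * ξ * r - r ^ 2) := by ring
  rw [this, hsign.2]
  linarith

/-- The pointwise lower bound for the gain of adaptive scaling over plain soft-thresholding. -/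
theorem loss_gain_ge (hk : (nonzeroSet β).card < n) (α : ℝ) {b : ℝ} (hb : 0 < b)
    (hβ : ∀ j, β j ≠ 0 → b ≤ |β j|) :
    ((nonzeroSet β).card : ℝ) * nullMax β ξ ^ 2
        - 2 * ∑ j ∈ nonzeroSet β, Real.sign (β j) * (nullMax β ξ * ξ j)
        - (nonzeroSet β).card * (28 / b * ‖ξ‖ ^ 3) ≤
      ∑ j, (softThreshold (β + ξ) (nonzeroSet β).card j - β j) ^ 2 -
      ∑ j, (adaptiveScale α (β + ξ) (nonzeroSet β).card j *
        softThreshold (β + ξ) (nonzeroSet β).card j - β j) ^ 2 := by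
  have hM0 := norm_nonneg ξ
  have hξ : ∀ j, |ξ j| ≤ ‖ξ‖ := norm_le_pi_norm ξ
  have hTM := nullMax_le_norm (β := β) (ξ := ξ)
  have hT0 := nullMax_nonneg (β := β) (ξ := ξ)
  have hlhs : ((nonzeroSet β).card : ℝ) * nullMax β ξ ^ 2
        - 2 * ∑ j ∈ nonzeroSet β, Real.sign (β j) * (nullMax β ξ * ξ j)
        - (nonzeroSet β).card * (28 / b * ‖ξ‖ ^ 3) =
      ∑ j ∈ nonzeroSet β, (nullMax β ξ ^ 2 - 2 * nullMax β ξ * (Real.sign (β j) * ξ j)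
        - 28 / b * ‖ξ‖ ^ 3) := by
    rw [Finset.sum_sub_distrib, Finset.sum_sub_distrib, Finset.sum_const, Finset.sum_const,
      nsmul_eq_mul, nsmul_eq_mul, Finset.mul_sum]
    congr 2
    exact Finset.sum_congr rfl fun j _ => by ring
  rw [hlhs, ← Finset.sum_sub_distrib]
  rcases le_or_gt ‖ξ‖ (b / 4) with hM | hM
  · have hθ := threshold_eq_nullMax (β := β) (ξ := ξ) hk fun i hi j hj => by
      have h1 := abs_sub_abs_le_abs_sub (β i) (-ξ i)
      rw [abs_neg, sub_neg_eq_add] at h1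
      linarith [hβ i hi, hξ i, hξ j]
    rw [← Finset.sum_subset (Finset.subset_univ (nonzeroSet β))]
    · refine Finset.sum_le_sum fun j hj => ?_
      have hj' := hβ j (mem_nonzeroSet.mp hj)
      have hlt : threshold (β + ξ) (nonzeroSet β).card < |(β + ξ) j| := by
        have h1 := abs_sub_abs_le_abs_sub (β j) (-ξ j)
        rw [abs_neg, sub_neg_eq_add] at h1
        rw [hθ, Pi.add_apply]
        linarith [hξ j]
      rw [adaptiveScale_mul_softThreshold_of_lt α hlt, softThreshold_of_lt hlt, hθ]
      exact sq_sub_sq_ge hb hj' hM (hξ j) hT0 hTM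
    · intro j _ hj
      have hj0 : β j = 0 := by simpa [mem_nonzeroSet] using hj
      have hle : |(β + ξ) j| ≤ threshold (β + ξ) (nonzeroSet β).card := by
        rw [hθ]
        simpa [hj0] using abs_le_nullMax (ξ := ξ) hj0
      simp [softThreshold_of_le hle]
  -- Large noise: at most `k*` coordinates are kept, discarded ones contribute equally to both
  -- losses, and each kept one costs at most `(2‖ξ‖)²`.
  · set B := Finset.univ.filter fun j => threshold (β + ξ) (nonzeroSet β).card < |(β + ξ) j|
      with hB
    have hBcard : (B.card : ℝ) ≤ (nonzeroSet β).card :=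
      Nat.cast_le.mpr (card_threshold_lt_abs_le _ _)
    have hR : -((nonzeroSet β).card * (2 * ‖ξ‖) ^ 2) ≤
        ∑ j, ((softThreshold (β + ξ) (nonzeroSet β).card j - β j) ^ 2 -
          (adaptiveScale α (β + ξ) (nonzeroSet β).card j *
            softThreshold (β + ξ) (nonzeroSet β).card j - β j) ^ 2) := by
      rw [← Finset.sum_subset (Finset.subset_univ B)]
      · calc -((nonzeroSet β).card * (2 * ‖ξ‖) ^ 2) ≤ -(B.card * (2 * ‖ξ‖) ^ 2) := by gcongr
          _ = ∑ j ∈ B, -(2 * ‖ξ‖) ^ 2 := by simp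
          _ ≤ _ := Finset.sum_le_sum fun j _ => by
            have h1 := sq_le_sq' (abs_le.mp (abs_adaptive_sub_le (ξ := ξ) hk α j)).1
              (abs_le.mp (abs_adaptive_sub_le (ξ := ξ) hk α j)).2
            nlinarith [sq_nonneg (softThreshold (β + ξ) (nonzeroSet β).card j - β j)]
      · intro j _ hj
        simp only [hB, Finset.mem_filter, Finset.mem_univ, true_and, not_lt] at hj
        simp [softThreshold_of_le hj]
    refine le_trans ?_ hR
    calc _ ≤ ∑ j ∈ nonzeroSet β, -(2 * ‖ξ‖) ^ 2 := Finset.sum_le_sum fun j _ => ?_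
      _ = _ := by simp
    -- The 7 collects 1 from `T²`, 2 from the cross term and 4 from `(2‖ξ‖)²`; with `‖ξ‖ > b/4` this
    -- yields the constant 28.
    have h7 : 7 * ‖ξ‖ ^ 2 ≤ 28 / b * ‖ξ‖ ^ 3 := by
      rw [div_mul_eq_mul_div, le_div_iff₀ hb]
      nlinarith [sq_nonneg ‖ξ‖, mul_nonneg (sq_nonneg ‖ξ‖) (sub_nonneg.mpr hM.le)]
    have hs : |Real.sign (β j) * ξ j| ≤ ‖ξ‖ := by
      rw [abs_mul]
      rcases Real.sign_apply_eq (β j) with hs | hs | hs <;> rw [hs] <;> simp [hξ j]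
    have hs' : -(nullMax β ξ * (Real.sign (β j) * ξ j)) ≤ ‖ξ‖ * ‖ξ‖ := by
      refine (neg_le_abs _).trans ?_
      rw [abs_mul, abs_of_nonneg hT0]
      gcongr
    have hsq : nullMax β ξ ^ 2 ≤ ‖ξ‖ ^ 2 := by gcongr
    nlinarith

end Losses

/-! ### One-dimensional Gaussian estimates. -/

section Gaussian

variable {Ω : Type*} [MeasurableSpace Ω] {P : Measure Ω}

/-- Bounds the density from below on `[a, a + 1]`, using `√(2π) ≤ 3`. The shift from `a` to `a + 1`
does not affect the leading constant of the maximum. -/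
theorem gaussianReal_Ici_ge {a : ℝ} (ha : 0 ≤ a) :
    Real.exp (-(a + 1) ^ 2 / 2) / 3 ≤ (gaussianReal 0 1).real (Set.Ici a) := by
  have hvol : volume.real (Set.Icc a (a + 1)) = 1 := by
    rw [Real.volume_real_Icc_of_le (by linarith)]; ring
  have hconst : Real.exp (-(a + 1) ^ 2 / 2) / 3 =
      ∫ _ in Set.Icc a (a + 1), Real.exp (-(a + 1) ^ 2 / 2) / 3 := by
    rw [setIntegral_const, hvol, one_smul]
  have hle : Real.exp (-(a + 1) ^ 2 / 2) / 3 ≤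
      ∫ x in Set.Icc a (a + 1), gaussianPDFReal 0 1 x := by
    rw [hconst]
    refine setIntegral_mono_on (by simp) (integrable_gaussianPDFReal 0 1).integrableOn
      measurableSet_Icc fun x hx => ?_
    rw [gaussianPDFReal_def]
    have h3 : √(2 * Real.pi * ((1 : NNReal) : ℝ)) ≤ 3 := by
      rw [Real.sqrt_le_left (by norm_num)]
      have := Real.pi_lt_d2
      norm_num
      linarith
    have hpos : 0 < √(2 * Real.pi * ((1 : NNReal) : ℝ)) := by
      have := Real.pi_pos
      simp only [NNReal.coe_one]
      positivity
    rw [div_eq_inv_mul]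
    have hexp : Real.exp (-(a + 1) ^ 2 / 2) ≤
        Real.exp (-(x - 0) ^ 2 / (2 * ((1 : NNReal) : ℝ))) := by
      refine Real.exp_le_exp.mpr ?_
      simp only [NNReal.coe_one, sub_zero, mul_one]
      have h1 := hx.1
      have h2 := hx.2
      have : x ^ 2 ≤ (a + 1) ^ 2 := by gcongr; linarith
      linarith
    exact mul_le_mul (inv_anti₀ hpos h3) hexp (by positivity) (by positivity)
  refine hle.trans ?_
  have h := gaussianReal_apply_eq_integral 0 (one_ne_zero (α := NNReal)) (Set.Icc a (a + 1))
  calc ∫ x in Set.Icc a (a + 1), gaussianPDFReal 0 1 x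
      = (gaussianReal 0 1).real (Set.Icc a (a + 1)) := by
        rw [measureReal_def, h, ENNReal.toReal_ofReal]
        exact integral_nonneg fun x => gaussianPDFReal_nonneg 0 1 x
    _ ≤ _ := measureReal_mono Set.Icc_subset_Ici_self

theorem hasLaw_div_of_gaussianReal {X : Ω → ℝ} {τ : ℝ} (hτ : 0 < τ)
    (hX : HasLaw X (gaussianReal 0 (τ ^ 2).toNNReal) P) :
    HasLaw (fun ω => X ω / τ) (gaussianReal 0 1) P := by
  have h := gaussianReal_div_const hX τ
  convert h using 1
  congr 1
  · simp
  · have h0 : (τ ^ 2).toNNReal ≠ 0 := by simpa using hτ.ne'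
    have : (NNReal.mk (τ ^ 2) (sq_nonneg τ)) = (τ ^ 2).toNNReal :=
      (Real.toNNReal_of_nonneg (sq_nonneg τ)).symm
    rw [this, div_self h0]

theorem integral_pow_of_gaussianReal {X : Ω → ℝ} {τ : ℝ} (hτ : 0 < τ)
    (hX : HasLaw X (gaussianReal 0 (τ ^ 2).toNNReal) P) (p : ℕ) :
    ∫ ω, X ω ^ p ∂P = τ ^ p * ∫ x, x ^ p ∂(gaussianReal 0 1) := by
  rw [← (hasLaw_div_of_gaussianReal hτ hX).integral_comp (f := fun x => x ^ p) (by fun_prop),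
    ← integral_const_mul]
  refine integral_congr_ae (.of_forall fun ω => ?_)
  simp only [Function.comp_apply]
  rw [← mul_pow, mul_div_cancel₀ _ hτ.ne']

theorem real_lt_of_gaussianReal_le {X : Ω → ℝ} {τ : ℝ} (hτ : 0 < τ)
    (hX : HasLaw X (gaussianReal 0 (τ ^ 2).toNNReal) P) {a : ℝ} (ha : 0 ≤ a) :
    P.real (X ⁻¹' Set.Iio (a * τ)) ≤ Real.exp (-(Real.exp (-(a + 1) ^ 2 / 2) / 3)) := by
  have h1 : X ⁻¹' Set.Iio (a * τ) = {ω | X ω / τ < a} := by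
    ext ω
    simp [div_lt_iff₀ hτ]
  have h2 : {x : ℝ | x < a} = (Set.Ici a)ᶜ := by ext; simp
  rw [h1, (hasLaw_div_of_gaussianReal hτ hX).measureReal_eq (p := fun x => x < a)
    measurableSet_Iio, h2, probReal_compl_eq_one_sub measurableSet_Ici]
  have := gaussianReal_Ici_ge ha
  have := Real.add_one_le_exp (-(Real.exp (-(a + 1) ^ 2 / 2) / 3))
  linarith

end Gaussian

/-! ### Law of the least squares noise. -/

section Noise

variable {Ω : Type*} [MeasurableSpace Ω] {P : Measure Ω}
  {n : ℕ} {G : Matrix (Fin n) (Fin n) ℝ} {e : Ω → Fin n → ℝ} {σ : ℝ}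

theorem leastSquares_apply (G : Matrix (Fin n) (Fin n) ℝ) (u : Fin n → ℝ) (j : Fin n) :
    leastSquares G u j = ∑ i, (G i j / n) * u i := by
  simp only [leastSquares, Pi.smul_apply, smul_eq_mul, Matrix.mulVec, dotProduct,
    Matrix.transpose_apply, Finset.mul_sum]
  exact Finset.sum_congr rfl fun i _ => by ring

theorem hasGaussianLaw_leastSquares
    (he : ∀ i, HasLaw (fun ω => e ω i) (gaussianReal 0 (σ ^ 2).toNNReal) P)
    (hind : iIndepFun (fun i ω => e ω i) P) :
    HasGaussianLaw (fun ω => leastSquares G (e ω)) P := by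
  have h : HasGaussianLaw e P := hind.hasGaussianLaw fun i => (he i).hasGaussianLaw
  exact h.map_fun (LinearMap.toContinuousLinearMap ((1 / (n : ℝ)) • Gᵀ.mulVecLin))

theorem integral_leastSquares
    (he : ∀ i, HasLaw (fun ω => e ω i) (gaussianReal 0 (σ ^ 2).toNNReal) P) (j : Fin n) :
    ∫ ω, leastSquares G (e ω) j ∂P = 0 := by
  simp_rw [leastSquares_apply]
  rw [integral_finsetSum _ fun i _ => ((he i).hasGaussianLaw.integrable).const_mul _]
  refine Finset.sum_eq_zero fun i _ => ?_
  rw [integral_const_mul, (he i).integral_eq]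
  simp

theorem covariance_leastSquares [IsProbabilityMeasure P] (hn : n ≠ 0)
    (hG : Gᵀ * G = (n : ℝ) • (1 : Matrix (Fin n) (Fin n) ℝ))
    (he : ∀ i, HasLaw (fun ω => e ω i) (gaussianReal 0 (σ ^ 2).toNNReal) P)
    (hind : iIndepFun (fun i ω => e ω i) P) (j l : Fin n) :
    cov[fun ω => leastSquares G (e ω) j, fun ω => leastSquares G (e ω) l; P] =
      if j = l then σ ^ 2 / n else 0 := by
  have hn' : (n : ℝ) ≠ 0 := Nat.cast_ne_zero.mpr hn
  have hL : ∀ i, MemLp (fun ω => e ω i) 2 P := fun i => (he i).hasGaussianLaw.memLp_two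
  have hcov : ∀ i i', cov[fun ω => e ω i, fun ω => e ω i'; P] = if i = i' then σ ^ 2 else 0 := by
    intro i i'
    split_ifs with h
    · subst h
      rw [covariance_self (he i).aemeasurable, (he i).variance_eq, variance_id_gaussianReal,
        Real.coe_toNNReal _ (sq_nonneg σ)]
    · exact (hind.indepFun h).covariance_eq_zero (hL i) (hL i')
  have hjl : ∑ i, G i j * G i l = if j = l then (n : ℝ) else 0 := by
    have := congrFun (congrFun hG j) l
    simpa [Matrix.mul_apply, Matrix.one_apply] using this
  simp_rw [leastSquares_apply]
  rw [covariance_fun_sum_fun_sum (fun i => (hL i).const_mul _) (fun i => (hL i).const_mul _)]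
  simp_rw [covariance_const_mul_left, covariance_const_mul_right, hcov]
  simp only [mul_ite, mul_zero, Finset.sum_ite_eq, Finset.mem_univ, if_true]
  calc ∑ i, G i j / n * (G i l / n * σ ^ 2)
      = (∑ i, G i j * G i l) * (σ ^ 2 / n ^ 2) := by
        rw [Finset.sum_mul]
        exact Finset.sum_congr rfl fun i _ => by field_simp
    _ = _ := by
        rw [hjl]
        split_ifs
        · field_simp
        · rw [zero_mul]

/-- The coordinates are jointly Gaussian, and `GᵀG = n I` makes them uncorrelated. -/
theorem iIndepFun_leastSquares [IsProbabilityMeasure P] (hn : n ≠ 0)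
    (hG : Gᵀ * G = (n : ℝ) • (1 : Matrix (Fin n) (Fin n) ℝ))
    (he : ∀ i, HasLaw (fun ω => e ω i) (gaussianReal 0 (σ ^ 2).toNNReal) P)
    (hind : iIndepFun (fun i ω => e ω i) P) :
    iIndepFun (fun j ω => leastSquares G (e ω) j) P :=
  (hasGaussianLaw_leastSquares he hind).iIndepFun_of_covariance_eq_zero fun j l hjl => by
    rw [covariance_leastSquares hn hG he hind, if_neg hjl]

theorem hasLaw_leastSquares [IsProbabilityMeasure P] (hn : n ≠ 0)
    (hG : Gᵀ * G = (n : ℝ) • (1 : Matrix (Fin n) (Fin n) ℝ))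
    (he : ∀ i, HasLaw (fun ω => e ω i) (gaussianReal 0 (σ ^ 2).toNNReal) P)
    (hind : iIndepFun (fun i ω => e ω i) P) (j : Fin n) :
    HasLaw (fun ω => leastSquares G (e ω) j) (gaussianReal 0 ((σ / √n) ^ 2).toNNReal) P := by
  have h : HasGaussianLaw (fun ω => leastSquares G (e ω) j) P :=
    (hasGaussianLaw_leastSquares he hind).map_fun (ContinuousLinearMap.proj j)
  refine ⟨h.aemeasurable, ?_⟩
  rw [h.map_eq_gaussianReal, integral_leastSquares he, ← covariance_self h.aemeasurable,
    covariance_leastSquares hn hG he hind, if_pos rfl, div_pow, Real.sq_sqrt (Nat.cast_nonneg n)]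

end Noise

/-! ### Expected gain in the sequence model. -/

section Expectation

variable {Ω : Type*} [MeasurableSpace Ω] {P : Measure Ω}
  {n : ℕ} {ξ : Ω → Fin n → ℝ} {τ : ℝ} {β : Fin n → ℝ}

theorem measurable_nullMax (β : Fin n → ℝ) : Measurable (nullMax β) := by
  unfold nullMax
  fun_prop

theorem memLp_nullMax (hG : HasGaussianLaw ξ P) : MemLp (fun ω => nullMax β (ξ ω)) 2 P := by
  refine hG.memLp_two.of_le
    ((measurable_nullMax β).comp_aemeasurable hG.aemeasurable).aestronglyMeasurable
    (.of_forall fun ω => ?_)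
  rw [Real.norm_of_nonneg nullMax_nonneg]
  exact nullMax_le_norm

theorem integrable_norm_pow [IsProbabilityMeasure P] (hG : HasGaussianLaw ξ P) (p : ℕ) :
    Integrable (fun ω => ‖ξ ω‖ ^ p) P :=
  (hG.memLp (p := p) (by simp)).integrable_norm_pow'

/-- Weighted AM-GM `2t ≤ 1/n + n t²` with `t = ‖ξ‖³`, followed by bounding the maximum of the `ξ_j⁶`
by their sum. For `τ² = σ²/n` the result is `O(1/n)`, free of the logarithm. -/
theorem integral_norm_pow_three_le [IsProbabilityMeasure P] (hn : n ≠ 0) (hτ : 0 < τ) (hG : HasGaussianLaw ξ P)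
    (hξ : ∀ j, HasLaw (fun ω => ξ ω j) (gaussianReal 0 (τ ^ 2).toNNReal) P) :
    ∫ ω, ‖ξ ω‖ ^ 3 ∂P ≤
      (n : ℝ)⁻¹ + (n : ℝ) ^ 2 * (τ ^ 6 * ∫ x, x ^ 6 ∂(gaussianReal 0 1)) := by
  have hn' : (0 : ℝ) < n := by positivity
  have : Nonempty (Fin n) := ⟨⟨0, Nat.pos_of_ne_zero hn⟩⟩
  have hint : ∀ j, Integrable (fun ω => ξ ω j ^ 6) P := fun j => by
    have := ((hξ j).hasGaussianLaw.memLp (p := (6 : ℕ)) (by simp)).integrable_norm_pow'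
    refine this.congr (.of_forall fun ω => ?_)
    simp only [Real.norm_eq_abs]
    exact Even.pow_abs (by decide) _
  have hpt : ∀ ω, ‖ξ ω‖ ^ 3 ≤ (n : ℝ)⁻¹ + n * ∑ j, ξ ω j ^ 6 := by
    intro ω
    obtain ⟨j, hmax⟩ := Finite.exists_max fun j => ‖ξ ω j‖
    have hj : ‖ξ ω j‖ = ‖ξ ω‖ := le_antisymm (norm_le_pi_norm _ j)
      ((pi_norm_le_iff_of_nonneg (norm_nonneg _)).mpr hmax)
    have h6 : ‖ξ ω‖ ^ 6 ≤ ∑ j, ξ ω j ^ 6 := by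
      rw [← hj, Real.norm_eq_abs, Even.pow_abs (by decide)]
      exact Finset.single_le_sum (f := fun j => ξ ω j ^ 6)
        (fun i _ => Even.pow_nonneg (by decide) _) (Finset.mem_univ j)
    have h0 : 0 ≤ ‖ξ ω‖ ^ 3 := by positivity
    have hsq : 0 ≤ (n : ℝ)⁻¹ * (n * ‖ξ ω‖ ^ 3 - 1) ^ 2 := by positivity
    have hsq' : (n : ℝ)⁻¹ * (n * ‖ξ ω‖ ^ 3 - 1) ^ 2 =
        n * ‖ξ ω‖ ^ 6 - 2 * ‖ξ ω‖ ^ 3 + (n : ℝ)⁻¹ := by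
      field_simp
      ring
    have := mul_le_mul_of_nonneg_left h6 hn'.le
    linarith
  calc ∫ ω, ‖ξ ω‖ ^ 3 ∂P ≤ ∫ ω, ((n : ℝ)⁻¹ + n * ∑ j, ξ ω j ^ 6) ∂P :=
        integral_mono (integrable_norm_pow hG 3)
          ((integrable_const _).add ((integrable_finsetSum _ fun j _ => hint j).const_mul _)) hpt
    _ = _ := by
        rw [integral_add (integrable_const _)
          ((integrable_finsetSum _ fun j _ => hint j).const_mul _), integral_const_mul,
          integral_finsetSum _ fun j _ => hint j]
        simp_rw [fun j => integral_pow_of_gaussianReal hτ (hξ j) 6]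
        simp
        ring

theorem integral_nullMax_mul_eq_zero [IsProbabilityMeasure P] (hG : HasGaussianLaw ξ P)
    (hξ : ∀ j, HasLaw (fun ω => ξ ω j) (gaussianReal 0 (τ ^ 2).toNNReal) P)
    (hind : iIndepFun (fun j ω => ξ ω j) P) {j : Fin n} (hj : j ∈ nonzeroSet β) :
    ∫ ω, nullMax β (ξ ω) * ξ ω j ∂P = 0 := by
  have hfin := hind.indepFun_finset₀ (nonzeroSet β)ᶜ {j} (by simpa using hj)
    fun i => (hξ i).aemeasurable
  have hproj : Measurable fun u : ({j} : Finset (Fin n)) → ℝ =>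
      u ⟨j, Finset.mem_singleton_self j⟩ := measurable_pi_apply _
  have h := hfin.comp measurable_norm hproj
  have h' : IndepFun (fun ω => nullMax β (ξ ω)) (fun ω => ξ ω j) P := h
  rw [h'.integral_fun_mul_eq_mul_integral (memLp_nullMax hG).aestronglyMeasurable
    (hξ j).aemeasurable.aestronglyMeasurable, (hξ j).integral_eq, integral_id_gaussianReal,
    mul_zero]

/-- A small maximum forces every null `ξ_j` below `aτ`; one-sided events suffice, and independence
gives a product. -/
theorem real_nullMax_lt_le [IsProbabilityMeasure P] (hτ : 0 < τ)
    (hξ : ∀ j, HasLaw (fun ω => ξ ω j) (gaussianReal 0 (τ ^ 2).toNNReal) P)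
    (hind : iIndepFun (fun j ω => ξ ω j) P) {a : ℝ} (ha : 0 ≤ a) :
    P.real {ω | nullMax β (ξ ω) < a * τ} ≤
      Real.exp (-((n - (nonzeroSet β).card) * (Real.exp (-(a + 1) ^ 2 / 2) / 3))) := by
  have hsub : {ω | nullMax β (ξ ω) < a * τ} ⊆
      ⋂ j ∈ (nonzeroSet β)ᶜ, (fun ω => ξ ω j) ⁻¹' Set.Iio (a * τ) := by
    intro ω hω
    simp only [Set.mem_iInter]
    intro j hj
    have hj0 : β j = 0 := by simpa [mem_nonzeroSet] using hj
    exact ((le_abs_self _).trans (abs_le_nullMax hj0)).trans_lt hω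
  have hprod := hind.measure_inter_preimage_eq_mul (nonzeroSet β)ᶜ
    (sets := fun _ => Set.Iio (a * τ)) fun _ _ => measurableSet_Iio
  have hcard : (((nonzeroSet β)ᶜ.card : ℕ) : ℝ) = n - (nonzeroSet β).card := by
    rw [Finset.card_compl, Nat.cast_sub (Finset.card_le_univ _), Fintype.card_fin]
  calc P.real {ω | nullMax β (ξ ω) < a * τ}
      ≤ P.real (⋂ j ∈ (nonzeroSet β)ᶜ, (fun ω => ξ ω j) ⁻¹' Set.Iio (a * τ)) :=
        measureReal_mono hsub
    _ = ∏ j ∈ (nonzeroSet β)ᶜ, P.real ((fun ω => ξ ω j) ⁻¹' Set.Iio (a * τ)) := by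
        rw [measureReal_def, hprod, ENNReal.toReal_prod]
        rfl
    _ ≤ ∏ j ∈ (nonzeroSet β)ᶜ, Real.exp (-(Real.exp (-(a + 1) ^ 2 / 2) / 3)) :=
        Finset.prod_le_prod (fun _ _ => measureReal_nonneg) fun j _ =>
          real_lt_of_gaussianReal_le hτ (hξ j) ha
    _ = _ := by
        rw [Finset.prod_const, ← Real.exp_nat_mul, hcard, mul_neg]

theorem integral_nullMax_sq_ge [IsProbabilityMeasure P] (hτ : 0 < τ) (hG : HasGaussianLaw ξ P)
    (hξ : ∀ j, HasLaw (fun ω => ξ ω j) (gaussianReal 0 (τ ^ 2).toNNReal) P)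
    (hind : iIndepFun (fun j ω => ξ ω j) P) {a : ℝ} (ha : 0 ≤ a) :
    (a * τ) ^ 2 *
      (1 - Real.exp (-((n - (nonzeroSet β).card) * (Real.exp (-(a + 1) ^ 2 / 2) / 3)))) ≤
      ∫ ω, nullMax β (ξ ω) ^ 2 ∂P := by
  have hmarkov := mul_meas_ge_le_integral_of_nonneg (μ := P)
    (f := fun ω => nullMax β (ξ ω) ^ 2) (.of_forall fun ω => sq_nonneg _)
    (memLp_nullMax hG).integrable_sq ((a * τ) ^ 2)
  -- Markov's inequality bounds the second moment below by `(aτ)²` times the probability that the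
  -- maximum reaches `aτ`.
  refine le_trans ?_ hmarkov
  have hset : {ω | (a * τ) ^ 2 ≤ nullMax β (ξ ω) ^ 2} = {ω | a * τ ≤ nullMax β (ξ ω)} := by
    ext ω
    exact pow_le_pow_iff_left₀ (by positivity) nullMax_nonneg two_ne_zero
  have hunion : 1 ≤ P.real {ω | a * τ ≤ nullMax β (ξ ω)} +
      P.real {ω | nullMax β (ξ ω) < a * τ} := by
    refine le_trans (le_of_eq ?_) (measureReal_union_le _ _)
    have : {ω | a * τ ≤ nullMax β (ξ ω)} ∪ {ω | nullMax β (ξ ω) < a * τ} = Set.univ := by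
      ext ω
      simpa using le_or_gt (a * τ) (nullMax β (ξ ω))
    rw [this, probReal_univ]
  have := real_nullMax_lt_le (β := β) hτ hξ hind ha
  rw [hset]
  gcongr
  linarith

theorem integrable_soft_loss [IsProbabilityMeasure P] (hk : (nonzeroSet β).card < n) (hG : HasGaussianLaw ξ P) :
    Integrable (fun ω =>
      ∑ j, (softThreshold (β + ξ ω) (nonzeroSet β).card j - β j) ^ 2) P := by
  refine integrable_finsetSum _ fun j _ => ?_
  refine Integrable.mono' ((integrable_norm_pow hG 2).const_mul 4) ?_ (.of_forall fun ω => ?_)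
  · have hm : Measurable fun u : Fin n → ℝ =>
        (softThreshold (β + u) (nonzeroSet β).card j - β j) ^ 2 :=
      (((measurable_softThreshold _ j).comp (measurable_const_add β)).sub_const _).pow_const 2
    exact (hm.comp_aemeasurable hG.aemeasurable).aestronglyMeasurable
  · rw [Real.norm_of_nonneg (sq_nonneg _)]
    have h := abs_le.mp (abs_softThreshold_sub_le (ξ := ξ ω) hk j)
    have := sq_le_sq' h.1 h.2
    linarith

theorem integrable_adaptive_loss [IsProbabilityMeasure P] (hk : (nonzeroSet β).card < n) (hG : HasGaussianLaw ξ P)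
    (α : ℝ) :
    Integrable (fun ω => ∑ j, (adaptiveScale α (β + ξ ω) (nonzeroSet β).card j *
        softThreshold (β + ξ ω) (nonzeroSet β).card j - β j) ^ 2) P := by
  refine integrable_finsetSum _ fun j _ => ?_
  refine Integrable.mono' ((integrable_norm_pow hG 2).const_mul 4) ?_ (.of_forall fun ω => ?_)
  · have hm : Measurable fun u : Fin n → ℝ =>
        (adaptiveScale α (β + u) (nonzeroSet β).card j *
          softThreshold (β + u) (nonzeroSet β).card j - β j) ^ 2 :=
      ((((measurable_adaptiveScale α _ j).mul (measurable_softThreshold _ j)).comp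
        (measurable_const_add β)).sub_const _).pow_const 2
    exact (hm.comp_aemeasurable hG.aemeasurable).aestronglyMeasurable
  · rw [Real.norm_of_nonneg (sq_nonneg _)]
    have h := abs_le.mp (abs_adaptive_sub_le (ξ := ξ ω) hk α j)
    have := sq_le_sq' h.1 h.2
    linarith

/-- The lower bound for the expected gain of adaptive scaling over plain soft-thresholding. -/
theorem integral_loss_gain_ge [IsProbabilityMeasure P] (hk : (nonzeroSet β).card < n) (hτ : 0 < τ)
    (hG : HasGaussianLaw ξ P)
    (hξ : ∀ j, HasLaw (fun ω => ξ ω j) (gaussianReal 0 (τ ^ 2).toNNReal) P)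
    (hind : iIndepFun (fun j ω => ξ ω j) P) (α : ℝ) {b : ℝ} (hb : 0 < b)
    (hβ : ∀ j, β j ≠ 0 → b ≤ |β j|) {a : ℝ} (ha : 0 ≤ a) :
    ((nonzeroSet β).card : ℝ) * ((a * τ) ^ 2 *
        (1 - Real.exp (-((n - (nonzeroSet β).card) * (Real.exp (-(a + 1) ^ 2 / 2) / 3)))) -
        28 / b * ((n : ℝ)⁻¹ + (n : ℝ) ^ 2 * (τ ^ 6 * ∫ x, x ^ 6 ∂(gaussianReal 0 1)))) ≤
      ∫ ω, ∑ j, (softThreshold (β + ξ ω) (nonzeroSet β).card j - β j) ^ 2 ∂P -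
      ∫ ω, ∑ j, (adaptiveScale α (β + ξ ω) (nonzeroSet β).card j *
        softThreshold (β + ξ ω) (nonzeroSet β).card j - β j) ^ 2 ∂P := by
  have hsoft := integrable_soft_loss hk hG
  have hada := integrable_adaptive_loss hk hG α
  have hT := (memLp_nullMax (β := β) hG).integrable_sq
  have hM := integrable_norm_pow hG 3
  have hprod : ∀ j, Integrable (fun ω => nullMax β (ξ ω) * ξ ω j) P := fun j =>
    (memLp_nullMax hG).integrable_mul (hξ j).hasGaussianLaw.memLp_two
  have hsum : Integrable (fun ω => 2 * ∑ j ∈ nonzeroSet β,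
      Real.sign (β j) * (nullMax β (ξ ω) * ξ ω j)) P :=
    (integrable_finsetSum _ fun j _ => (hprod j).const_mul _).const_mul _
  have hmono := integral_mono
    (((hT.const_mul ((nonzeroSet β).card : ℝ)).sub hsum).sub
      ((hM.const_mul (28 / b)).const_mul ((nonzeroSet β).card : ℝ))) (hsoft.sub hada)
    fun ω => loss_gain_ge (ξ := ξ ω) hk α hb hβ
  have hzero : ∫ ω, 2 * ∑ j ∈ nonzeroSet β,
      Real.sign (β j) * (nullMax β (ξ ω) * ξ ω j) ∂P = 0 := by
    rw [integral_const_mul, integral_finsetSum _ fun j _ => (hprod j).const_mul _,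
      Finset.sum_eq_zero, mul_zero]
    intro j hj
    rw [integral_const_mul, integral_nullMax_mul_eq_zero hG hξ hind hj, mul_zero]
  rw [integral_sub' hsoft hada, integral_sub' ((hT.const_mul _).sub hsum)
    ((hM.const_mul _).const_mul _), integral_sub' (hT.const_mul _) hsum, hzero,
    integral_const_mul, integral_const_mul, integral_const_mul] at hmono
  refine le_trans ?_ hmono
  rw [sub_zero, ← mul_sub]
  have h1 := integral_nullMax_sq_ge (β := β) hτ hG hξ hind ha
  have h2 := integral_norm_pow_three_le (by omega) hτ hG hξ
  have hb' : 0 ≤ 28 / b := by positivity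
  gcongr

end Expectation

/-! ### Asymptotics in the sample size, and assembly. -/

theorem eventually_log_le_gain {σ ε : ℝ} (hσ : 0 < σ) (hε : 0 < ε) (hε1 : ε < 1) (k : ℕ) (C : ℝ) :
    ∀ᶠ n : ℕ in Filter.atTop, ∃ a : ℝ, 0 ≤ a ∧ (1 - ε) * (2 * σ ^ 2 * Real.log n) ≤
      a ^ 2 * σ ^ 2 * (1 - Real.exp (-((n - k) * (Real.exp (-(a + 1) ^ 2 / 2) / 3)))) - C := by
  -- Half of `ε` goes into the level `s`; the other half absorbs the tail, the shift by one and `C`.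
  obtain ⟨δ, rfl⟩ : ∃ δ, ε = 2 * δ := ⟨ε / 2, by ring⟩
  have hδ : 0 < δ := by linarith
  have hL : Filter.Tendsto (fun n : ℕ => Real.log n) Filter.atTop Filter.atTop :=
    Real.tendsto_log_atTop.comp tendsto_natCast_atTop_atTop
  have hexp : Filter.Tendsto (fun n : ℕ => Real.exp (-(Real.exp (δ * Real.log n) / 6)))
      Filter.atTop (nhds 0) :=
    Real.tendsto_exp_neg_atTop_nhds_zero.comp
      ((Real.tendsto_exp_atTop.comp (hL.const_mul_atTop hδ)).atTop_div_const (by norm_num))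
  have hs : Filter.Tendsto (fun n : ℕ => √(2 * (1 - δ) * Real.log n))
      Filter.atTop Filter.atTop :=
    Real.tendsto_sqrt_atTop.comp (hL.const_mul_atTop (by linarith))
  filter_upwards [hexp.eventually_le_const (show 0 < δ / 4 by positivity),
    hs.eventually_ge_atTop (8 / δ), hs.eventually_ge_atTop 1,
    hL.eventually_ge_atTop (C / (δ * σ ^ 2)), hL.eventually_ge_atTop 0,
    Filter.eventually_ge_atTop (2 * k), Filter.eventually_gt_atTop 0]
    with n h1 h2 h3 h4 h5 h6 h7
  have hn : (0 : ℝ) < n := Nat.cast_pos.mpr h7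
  have hk : (n : ℝ) / 2 ≤ n - k := by
    have : ((2 * k : ℕ) : ℝ) ≤ n := Nat.cast_le.mpr h6
    push_cast at this
    linarith
  set L := Real.log n with hLdef
  set s := √(2 * (1 - δ) * L) with hsdef
  have hs2 : s ^ 2 = 2 * (1 - δ) * L := Real.sq_sqrt (mul_nonneg (by linarith) h5)
  -- The shift cancels the `a + 1` of the tail bound: `n exp(-s²/2) = n^δ`, so the exponent still
  -- diverges. Its cost is `(s - 1)² ≥ s²(1 - δ/4)`, from `δ s ≥ 8`.
  refine ⟨s - 1, by linarith, ?_⟩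
  have htail : Real.exp (-((n - k) * (Real.exp (-(s - 1 + 1) ^ 2 / 2) / 3))) ≤ δ / 4 := by
    refine le_trans (Real.exp_le_exp.mpr (neg_le_neg ?_)) h1
    have hE : Real.exp (δ * L) = n * Real.exp (-(s - 1 + 1) ^ 2 / 2) := by
      have hn' : (n : ℝ) = Real.exp L := (Real.exp_log hn).symm
      rw [sub_add_cancel, hs2, hn', ← Real.exp_add]
      congr 1
      ring
    rw [hE]
    have h0 := Real.exp_pos (-(s - 1 + 1) ^ 2 / 2)
    calc n * Real.exp (-(s - 1 + 1) ^ 2 / 2) / 6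
        = n / 2 * (Real.exp (-(s - 1 + 1) ^ 2 / 2) / 3) := by ring
      _ ≤ _ := by gcongr
  have h8 : 8 ≤ δ * s := by
    rw [div_le_iff₀ hδ] at h2
    linarith
  have ha : 2 * (1 - δ) * L * (1 - δ / 4) ≤ (s - 1) ^ 2 := by
    rw [← hs2]
    nlinarith
  have hC : C ≤ L * (δ * σ ^ 2) := by
    rwa [div_le_iff₀ (by positivity)] at h4
  have hσ2 : 0 < σ ^ 2 := by positivity
  calc (1 - 2 * δ) * (2 * σ ^ 2 * L)
      ≤ 2 * (1 - δ) * L * (1 - δ / 4) * σ ^ 2 * (1 - δ / 4) - L * (δ * σ ^ 2) := by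
        have hid : 2 * (1 - δ) * L * (1 - δ / 4) * σ ^ 2 * (1 - δ / 4) - L * (δ * σ ^ 2) -
            (1 - 2 * δ) * (2 * σ ^ 2 * L) =
            2 * σ ^ 2 * L * (δ ^ 2 * ((9 - δ) / 16)) := by ring
        have : 0 ≤ 2 * σ ^ 2 * L * (δ ^ 2 * ((9 - δ) / 16)) :=
          mul_nonneg (by positivity) (mul_nonneg (sq_nonneg δ) (by linarith))
        linarith
    _ ≤ (s - 1) ^ 2 * σ ^ 2 * (1 - δ / 4) - C := by
        have h14 : 0 ≤ 1 - δ / 4 := by linarith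
        gcongr
    _ ≤ _ := by gcongr

theorem card_nonzeroSet {β : ℕ →₀ ℝ} {n : ℕ} (hβ : ∀ j ∈ β.support, j < n) :
    (nonzeroSet fun j : Fin n => β j).card = β.support.card := by
  rw [← Finset.card_map Fin.valEmbedding]
  congr 1
  ext j
  simp only [Finset.mem_map, mem_nonzeroSet, Fin.valEmbedding_apply, Finsupp.mem_support_iff]
  constructor
  · rintro ⟨i, hi, rfl⟩
    exact hi
  · intro hj
    exact ⟨⟨j, hβ j (Finsupp.mem_support_iff.mpr hj)⟩, hj, rfl⟩

theorem exists_pos_le_abs (β : ℕ →₀ ℝ) : ∃ b : ℝ, 0 < b ∧ ∀ j, β j ≠ 0 → b ≤ |β j| := by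
  rcases β.support.eq_empty_or_nonempty with h | h
  · exact ⟨1, one_pos, fun j hj => by simp [Finsupp.support_eq_empty.mp h] at hj⟩
  · obtain ⟨i, hi, hmin⟩ := Finset.exists_min_image β.support (fun j => |β j|) h
    exact ⟨|β i|, abs_pos.mpr (Finsupp.mem_support_iff.mp hi),
      fun j hj => hmin j (Finsupp.mem_support_iff.mpr hj)⟩

end AdaptiveScaling

theorem theorem3 (σ : ℝ) (hσ : 0 < σ) (β : ℕ →₀ ℝ) (ε : ℝ) (hε : 0 < ε) :
    ∃ N : ℕ, ∀ n : ℕ, N ≤ n →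
      ∀ (m : ℕ) (g : ℕ → (Fin m → ℝ) → ℝ) (h : (Fin m → ℝ) → ℝ) (x : Fin n → Fin m → ℝ),
        (∀ z, h z = ∑ j : Fin n, β j * g j z) →
        (AdaptiveScaling.designMatrix g x)ᵀ * AdaptiveScaling.designMatrix g x =
          (n : ℝ) • (1 : Matrix (Fin n) (Fin n) ℝ) →
        ∀ (Ω : Type*) [MeasurableSpace Ω] (P : Measure Ω) [IsProbabilityMeasure P]
          (e y : Ω → Fin n → ℝ) (α : ℝ),
          (∀ i, HasLaw (fun ω => e ω i) (gaussianReal 0 (σ ^ 2).toNNReal) P) →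
          iIndepFun (fun i ω => e ω i) P →
          (∀ ω i, y ω i = h (x i) + e ω i) →
          Integrable (fun ω => AdaptiveScaling.scaledLoss (AdaptiveScaling.designMatrix g x)
            (fun i => h (x i)) β.support.card (fun _ => 1) (y ω)) P ∧
          Integrable (fun ω => AdaptiveScaling.adaptiveLoss α (AdaptiveScaling.designMatrix g x)
            (fun j => β j) β.support.card (y ω)) P ∧
          (1 - ε) * (2 * σ ^ 2 * β.support.card * (Real.log n / n)) ≤
            AdaptiveScaling.scaledRisk P (AdaptiveScaling.designMatrix g x)
                (fun i => h (x i)) β.support.card (fun _ => 1) y -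
              AdaptiveScaling.adaptiveRisk P α (AdaptiveScaling.designMatrix g x)
                (fun j => β j) β.support.card y ∧
          (0 < β.support.card →
            AdaptiveScaling.adaptiveRisk P α (AdaptiveScaling.designMatrix g x)
                (fun j => β j) β.support.card y <
              AdaptiveScaling.scaledRisk P (AdaptiveScaling.designMatrix g x)
                (fun i => h (x i)) β.support.card (fun _ => 1) y) := by
  open AdaptiveScaling in
  obtain ⟨b, hb, hβb⟩ := exists_pos_le_abs β
  set k := β.support.card
  -- Capping `ε` keeps `1 - ε` positive, which the strict inequality needs.
  have hε' : 0 < min ε (1 / 2) := lt_min hε (by norm_num)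
  -- Besides the gain estimate, `n` must exceed `k*` (otherwise the threshold takes its default
  -- value 0) and every index of the support (so that no coefficient is cut off); `n > 1` gives `log
  -- n > 0`.
  obtain ⟨N, hN⟩ := Filter.eventually_atTop.mp
    ((((eventually_log_le_gain hσ hε' ((min_le_right _ _).trans_lt (by norm_num)) k
      (28 / b * (1 + σ ^ 6 * ∫ x, x ^ 6 ∂(gaussianReal 0 1)))).and
      (Filter.eventually_gt_atTop k)).and (Filter.eventually_gt_atTop (β.support.sup id))).and
      (Filter.eventually_gt_atTop 1))
  refine ⟨N, fun n hn m g h x hh hG Ω _ P _ e y α he hind hy => ?_⟩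
  obtain ⟨⟨⟨⟨a, ha, hgain⟩, hkn⟩, hsup⟩, h1n⟩ := hN n hn
  have hn0 : n ≠ 0 := by omega
  have hnpos : (0 : ℝ) < n := by positivity
  set G := designMatrix g x
  set βn : Fin n → ℝ := fun j => β j
  have hcard : (nonzeroSet βn).card = k := card_nonzeroSet fun j hj =>
    (Finset.le_sup (f := id) hj).trans_lt hsup
  have hmean : (fun i => h (x i)) = G *ᵥ βn := by
    ext i
    rw [hh, Matrix.mulVec, dotProduct]
    exact Finset.sum_congr rfl fun j _ => mul_comm _ _
  have hy' : ∀ ω, y ω = G *ᵥ βn + e ω := fun ω => by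
    rw [← hmean]
    exact funext (hy ω)
  have hτ : 0 < σ / √n := by positivity
  have hgauss := hasGaussianLaw_leastSquares (G := G) he hind
  have hlaw := hasLaw_leastSquares hn0 hG he hind
  have hindep := iIndepFun_leastSquares hn0 hG he hind
  have hkn' : (nonzeroSet βn).card < n := hcard ▸ hkn
  have hbound := integral_loss_gain_ge hkn' hτ hgauss hlaw hindep α hb (fun j => hβb j) ha
  have hI1 := integrable_soft_loss hkn' hgauss
  have hI2 := integrable_adaptive_loss hkn' hgauss α
  simp only [scaledRisk, adaptiveRisk, hmean, hy', scaledLoss_one hn0 hG,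
    adaptiveLoss_eq hn0 hG]
  rw [hcard] at hbound hI1 hI2
  have hlogpos : 0 < Real.log n := Real.log_pos (by exact_mod_cast h1n)
  have hτ2 : (σ / √n) ^ 2 = σ ^ 2 / n := by rw [div_pow, Real.sq_sqrt hnpos.le]
  have hmain : (1 - min ε (1 / 2)) * (2 * σ ^ 2 * k * (Real.log n / n)) ≤
      ∫ ω, ∑ j, (softThreshold (βn + leastSquares G (e ω)) k j - βn j) ^ 2 ∂P -
      ∫ ω, ∑ j, (adaptiveScale α (βn + leastSquares G (e ω)) k j *
        softThreshold (βn + leastSquares G (e ω)) k j - βn j) ^ 2 ∂P := by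
    refine le_trans ?_ hbound
    have h6 : (σ / √n) ^ 6 = (σ ^ 2 / n) ^ 3 := by rw [← hτ2]; ring
    rw [mul_pow, h6, hτ2]
    have hkn0 : 0 ≤ (k : ℝ) / n := by positivity
    refine (le_of_eq ?_).trans ((mul_le_mul_of_nonneg_left hgain hkn0).trans (le_of_eq ?_))
    · ring
    · field_simp
  refine ⟨hI1, hI2, le_trans ?_ hmain, fun hkpos => ?_⟩
  · have : 0 ≤ 2 * σ ^ 2 * k * (Real.log n / n) := by positivity
    gcongr
    exact min_le_left _ _
  · rw [← sub_pos]
    refine lt_of_lt_of_le ?_ hmain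
    have h2 : 0 < 1 - min ε (1 / 2) := by linarith [min_le_right ε (1 / 2)]
    have h3 : (0 : ℝ) < k := Nat.cast_pos.mpr hkpos
    positivity
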